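/- **Conventions.** Let $f(S,T)\in\mathbb{C}[S,T]$ and consider the autonomous equation $f(y',y)=0$. * A *branch point* of $f$ is a $z_0\in\mathbb{C}$ for which there are $m>1$ and a convergent Laurent series $y$ in $(z-z_0)^{1/m}$ which satisfies $f(y',y)=0$ and is not a convergent Laurent series in $z-z_0$. * A *solution continued along a curve* $\gamma:[0,1]\to\mathbb{C}$ (continuous) is a family of germs $y_t$ at $\gamma(t)$, $0\le t<1$, of meromorphic functions satisfying $f(y',y)=0$, such that for every $t$ and all $s$ close to $t$ the germ $y_s$ is induced by $y_t$. Put $z_0=\gamma(1)$. The continued solution *has at most a pole at $z_0$* if there is a function $g$, meromorphic at $z_0$, that induces $y_t$ for all $t<1$ close to $1$. It *has an essential singularity at $z_0$* if there are no $m\ge 1$ and convergent Laurent series $Y$ such that, for all $t<1$ close to $1$, the germ $y_t$ equals $Y((z-z_0)^{1/m})$ for some local branch of $(z-z_0)^{1/m}$ at $\gamma(t)$ (that is, the singularity at $z_0$ is neither a pole nor an algebraic branch point). An *essential singularity* of $f$ is a point $z_0\in\mathbb{C}$ at which some continued solution has an essential singularity. * $f$ has the *Painlevé property* if the set of branch points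 and the set of essential singularities of $f$ are both discrete subsets of $\mathbb{C}$. **Corollary 2.3.** The following equations have the Painlevé property, and moreover every solution continued along any curve in $\mathbb{C}$ has at most a pole at the end point of the curve, so that the only singularities of solutions in the finite plane (in particular, the only movable ones) are poles: * (a) the Riccati equations $g'=a_0+a_1g+a_2g^2$ with $a_0,a_1,a_2\in\mathbb{C}$; * (b) the Weierstrass equations $(\lambda g')^2=g^3+ag+b$ with $\lambda\in\mathbb{C}^*$ and $a,b\in\mathbb{C}$, where the curve $y^2=x^3+ax+b$ is non-singular, i.e. $4a^3+27b^2\neq 0$. -/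

import Mathlib

open Filter Topology

/-!
Autonomous differential equations `f(y', y) = 0` of order one over the complex numbers, where
`f(S, T)` is a polynomial in two variables: `S = X 0` stands for `y'` and `T = X 1` for `y`.
-/

/-- `y` satisfies `f(y', y) = 0` at the point `z`. -/
def SatisfiesAt (f : MvPolynomial (Fin 2) ℂ) (y : ℂ → ℂ) (z : ℂ) : Prop :=
  MvPolynomial.eval ![deriv y z, y z] f = 0

/-- `y` is (the germ at `z₀` of) a meromorphic solution of `f(y', y) = 0`. -/
def IsSolutionAt (f : MvPolynomial (Fin 2) ℂ) (y : ℂ → ℂ) (z₀ : ℂ) : Prop :=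
  MeromorphicAt y z₀ ∧ ∀ᶠ z in 𝓝[≠] z₀, SatisfiesAt f y z

/-- There is a branched solution of `f(y', y) = 0` at `z₀`: an element
`y = Y((z - z₀)^{1/m})`, with `m > 1`, of the field of convergent Laurent series in
`(z - z₀)^{1/m}` which satisfies the equation and is not a convergent Laurent series in `z - z₀`.
In the coordinate `t` with `z = z₀ + t ^ m` one has `d/dz = (m t^{m-1})⁻¹ d/dt`. -/
def IsBranchPoint (f : MvPolynomial (Fin 2) ℂ) (z₀ : ℂ) : Prop :=
  ∃ (m : ℕ) (Y : ℂ → ℂ), 1 < m ∧ MeromorphicAt Y 0 ∧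
    (∀ᶠ t in 𝓝[≠] (0 : ℂ),
      MvPolynomial.eval ![deriv Y t / ((m : ℂ) * t ^ (m - 1)), Y t] f = 0) ∧
    ¬ ∃ h : ℂ → ℂ, MeromorphicAt h z₀ ∧ ∀ᶠ t in 𝓝[≠] (0 : ℂ), Y t = h (z₀ + t ^ m)

/-- A solution of `f(y', y) = 0` continued meromorphically along the half-open curve
`γ(t)`, `0 ≤ t < 1`, whose end point is `γ 1`: for every `t` a germ `y t` at `γ t` of a meromorphic
solution, such that the germ at `γ s` is induced by the germ at `γ t` for all `s` close to `t`. -/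
structure IsSolutionAlong (f : MvPolynomial (Fin 2) ℂ) (γ : ℝ → ℂ) (y : ℝ → ℂ → ℂ) : Prop where
  continuousOn : ContinuousOn γ (Set.Icc 0 1)
  isSolutionAt : ∀ t ∈ Set.Ico (0 : ℝ) 1, IsSolutionAt f (y t) (γ t)
  compatible : ∀ t ∈ Set.Ico (0 : ℝ) 1, ∀ᶠ s in 𝓝[Set.Ico (0 : ℝ) 1] t,
    y s =ᶠ[𝓝[≠] (γ s)] y t

/-- Near the end point `γ 1`, the continuation is given by a function meromorphic at `γ 1`:
it has there at most a pole. -/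
def EndsMeromorphically (γ : ℝ → ℂ) (y : ℝ → ℂ → ℂ) : Prop :=
  ∃ g : ℂ → ℂ, MeromorphicAt g (γ 1) ∧ ∀ᶠ t in 𝓝[<] (1 : ℝ), y t =ᶠ[𝓝[≠] (γ t)] g

/-- Near the end point `z₀ = γ 1`, the continuation is given by branches of a convergent Laurent
series in `(z - z₀)^{1/m}` for some `m ≥ 1`: it has there at most a pole or an algebraic branch
point. Here `σ` is a local branch of `(z - z₀)^{1/m}` near `γ t`. -/
def EndsAlgebraically (γ : ℝ → ℂ) (y : ℝ → ℂ → ℂ) : Prop :=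
  ∃ (m : ℕ) (Y : ℂ → ℂ), 1 ≤ m ∧ MeromorphicAt Y 0 ∧
    ∀ᶠ t in 𝓝[<] (1 : ℝ), ∃ σ : ℂ → ℂ, AnalyticAt ℂ σ (γ t) ∧
      (∀ᶠ z in 𝓝 (γ t), σ z ^ m = z - γ 1) ∧ y t =ᶠ[𝓝[≠] (γ t)] fun z => Y (σ z)

/-- `z₀` is an essential singularity of some solution of `f(y', y) = 0`: some continuation of a
solution along a curve ending at `z₀` has there a singularity which is neither a pole nor an
algebraic branch point. -/
def IsEssentialSingularity (f : MvPolynomial (Fin 2) ℂ) (z₀ : ℂ) : Prop :=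
  ∃ (γ : ℝ → ℂ) (y : ℝ → ℂ → ℂ), γ 1 = z₀ ∧ IsSolutionAlong f γ y ∧ ¬ EndsAlgebraically γ y

/-- The Painlevé property: both the set of branch points and the set of essential singularities
of the solutions are discrete. -/
def HasPainleveProperty (f : MvPolynomial (Fin 2) ℂ) : Prop :=
  IsDiscrete {z₀ : ℂ | IsBranchPoint f z₀} ∧ IsDiscrete {z₀ : ℂ | IsEssentialSingularity f z₀}

/-- The only singularities of solutions in the finite plane are poles: however a solution is
continued, along whatever curve, it has at most a pole at the end point. -/
def OnlySingularitiesArePoles (f : MvPolynomial (Fin 2) ℂ) : Prop :=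
  ∀ (γ : ℝ → ℂ) (y : ℝ → ℂ → ℂ), IsSolutionAlong f γ y → EndsMeromorphically γ y

/-- The Riccati equation `y' = a₀ + a₁ y + a₂ y ^ 2`. -/
noncomputable def riccati (a₀ a₁ a₂ : ℂ) : MvPolynomial (Fin 2) ℂ :=
  .X 0 - (.C a₀ + .C a₁ * .X 1 + .C a₂ * .X 1 ^ 2)

/-- The Weierstrass equation `(c y') ^ 2 = y ^ 3 + a y + b`. -/
noncomputable def weierstrass (c a b : ℂ) : MvPolynomial (Fin 2) ℂ :=
  (.C c * .X 0) ^ 2 - (.X 1 ^ 3 + .C a * .X 1 + .C b)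

/-! Both equations are polynomial vector fields on a compact curve: the projective line for Riccati,
the projective cubic for Weierstrass. Two affine charts with bounded coordinates cover the curve,
and in each the solution satisfies a quadratic system. Adjoining the constant function 1 makes the
system homogeneous. Its Taylor coefficients are then dominated by a geometric sequence depending
only on the system and the bound (`norm_iteratedDeriv_le_of_quadratic`). Hence one radius `r` serves
all points and all solutions (`UniformlyExtends`).

Once a curve stays within `r / 2` of its end point, a single meromorphic extension covers the end
point, and the identity theorem carries it along the rest of the curve. This also excludes branch
points, since a branched solution can be followed along a ray into its centre. -/

/-! ### Uniform radius of convergence for quadratic systems -/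

/-- A function whose Taylor coefficients at `z` grow at most like `K ^ n` extends analytically to
the disc of radius `K⁻¹` around `z`. -/
theorem AnalyticAt.exists_analyticOnNhd_ball {f : ℂ → ℂ} {z : ℂ} {M K : ℝ} (hK : 0 < K)
    (hf : AnalyticAt ℂ f z)
    (hM : ∀ n : ℕ, ‖iteratedDeriv n f z‖ ≤ M * n.factorial * K ^ n) :
    ∃ g : ℂ → ℂ, AnalyticOnNhd ℂ g (Metric.ball z K⁻¹) ∧ f =ᶠ[𝓝 z] g := by
  set p := FormalMultilinearSeries.ofScalars ℂ (fun n ↦ iteratedDeriv n f z / n.factorial) with hp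
  have hrad : ENNReal.ofReal K⁻¹ ≤ p.radius := by
    refine p.le_radius_of_bound M fun n => ?_
    have hn : (0 : ℝ) < n.factorial := by positivity
    rw [hp, FormalMultilinearSeries.ofScalars_norm, norm_div, Complex.norm_natCast,
      Real.coe_toNNReal _ (by positivity)]
    calc _ ≤ (M * n.factorial * K ^ n) / n.factorial * (K⁻¹) ^ n := by
          gcongr
          exact hM n
      _ = M := by
          rw [inv_pow]
          field_simp
  have hpos : 0 < p.radius := lt_of_lt_of_le (ENNReal.ofReal_pos.2 (inv_pos.2 hK)) hrad
  have hg : HasFPowerSeriesOnBall (fun w => p.sum (w - z)) p z p.radius := by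
    simpa using (p.hasFPowerSeriesOnBall hpos).comp_sub z
  refine ⟨_, fun w hw => hg.analyticOnNhd w ?_, ?_⟩
  · refine Metric.eball_subset_eball hrad ?_
    rwa [Metric.eball_ofReal]
  · have h2 := hg.hasFPowerSeriesAt.eventually_hasSum_sub
    filter_upwards [hf.hasFPowerSeriesAt.eventually_hasSum_sub, h2] with w h h'
    exact h.unique h'

/-- Cauchy's estimates propagate through a homogeneous quadratic differential equation. -/
theorem norm_iteratedDeriv_le_of_quadratic {ι : Type*} [Fintype ι] (B : ι → ι → ι → ℂ) {M K : ℝ}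
    (hM : 0 ≤ M) (hK : ∀ i, (∑ j, ∑ k, ‖B i j k‖) * M ≤ K) {x : ι → ℂ → ℂ} {z : ℂ}
    (hx : ∀ i, AnalyticAt ℂ (x i) z) (hz : ∀ i, ‖x i z‖ ≤ M)
    (hd : ∀ i, deriv (x i) =ᶠ[𝓝 z] fun w => ∑ j, ∑ k, B i j k * (x j w * x k w)) (n : ℕ) (i : ι) :
    ‖iteratedDeriv n (x i) z‖ ≤ M * n.factorial * K ^ n := by
  induction n using Nat.strong_induction_on generalizing i with
  | _ n ih =>
  have hK0 : 0 ≤ K := le_trans (by positivity) (hK i)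
  rcases n with _ | n
  · simpa using hz i
  have hc : ∀ j, ContDiffAt ℂ n (x j) z := fun j => (hx j).contDiffAt
  -- In the Leibniz rule the binomial coefficient cancels the factorials, so each of the `n + 1`
  -- terms is at most `M * M * n! * K ^ n`; their number turns `n!` into `(n + 1)!`.
  have key : ∀ j k, ‖iteratedDeriv n (fun w => x j w * x k w) z‖ ≤
      M * M * (n + 1).factorial * K ^ n := by
    intro j k
    rw [iteratedDeriv_fun_mul (hc j) (hc k)]
    refine (norm_sum_le _ _).trans ?_
    calc _ ≤ ∑ l ∈ Finset.range (n + 1), M * M * n.factorial * K ^ n := by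
          refine Finset.sum_le_sum fun l hl => ?_
          have hl' : l ≤ n := by simpa [Nat.lt_succ_iff] using hl
          rw [norm_mul, norm_mul, Complex.norm_natCast]
          have h1 := ih l (by omega) j
          have h2 := ih (n - l) (by omega) k
          calc _ ≤ (n.choose l : ℝ) * (M * l.factorial * K ^ l) *
                (M * (n - l).factorial * K ^ (n - l)) := by gcongr
            _ = M * M * ((n.choose l * l.factorial * (n - l).factorial : ℕ) : ℝ) *
                (K ^ l * K ^ (n - l)) := by push_cast; ring
            _ = _ := by rw [Nat.choose_mul_factorial_mul_factorial hl', ← pow_add,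
                  Nat.add_sub_cancel' hl']
      _ = _ := by
          rw [Finset.sum_const, Finset.card_range, Nat.factorial_succ]
          push_cast
          simp only [nsmul_eq_mul]
          push_cast
          ring
  have e : iteratedDeriv (n + 1) (x i) z =
      ∑ j, ∑ k, B i j k * iteratedDeriv n (fun w => x j w * x k w) z := by
    rw [iteratedDeriv_succ', (hd i).iteratedDeriv_eq n, iteratedDeriv_fun_sum]
    · refine Finset.sum_congr rfl fun j _ => ?_
      rw [iteratedDeriv_fun_sum]
      · refine Finset.sum_congr rfl fun k _ => ?_
        exact iteratedDeriv_const_mul _ ((hc j).mul (hc k))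
      · exact fun k _ => contDiffAt_const.mul ((hc j).mul (hc k))
    · exact fun j _ => ContDiffAt.sum fun k _ => contDiffAt_const.mul ((hc j).mul (hc k))
  rw [e]
  calc _ ≤ ∑ j, ∑ k, ‖B i j k‖ * (M * M * (n + 1).factorial * K ^ n) := by
        refine (norm_sum_le _ _).trans (Finset.sum_le_sum fun j _ => ?_)
        refine (norm_sum_le _ _).trans (Finset.sum_le_sum fun k _ => ?_)
        rw [norm_mul]
        gcongr
        exact key j k
    _ = ((∑ j, ∑ k, ‖B i j k‖) * M) * (M * (n + 1).factorial * K ^ n) := by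
        simp only [← Finset.sum_mul]
        ring
    _ ≤ K * (M * (n + 1).factorial * K ^ n) := by
        gcongr
        exact hK i
    _ = _ := by ring

/-- Analytic solutions of a homogeneous quadratic system which are bounded by `M` at a point extend
to a disc around this point whose radius only depends on the system and on `M`. -/
theorem exists_radius_of_quadratic {ι : Type*} [Fintype ι] (B : ι → ι → ι → ℂ) (M : ℝ) :
    ∃ r > 0, ∀ (x : ι → ℂ → ℂ) (z : ℂ), (∀ i, AnalyticAt ℂ (x i) z) → (∀ i, ‖x i z‖ ≤ M) →
      (∀ i, deriv (x i) =ᶠ[𝓝 z] fun w => ∑ j, ∑ k, B i j k * (x j w * x k w)) →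
      ∀ i, ∃ g : ℂ → ℂ, AnalyticOnNhd ℂ g (Metric.ball z r) ∧ x i =ᶠ[𝓝 z] g := by
  have hS : 0 ≤ ∑ i, ∑ j, ∑ k, ‖B i j k‖ := by positivity
  -- The `+ 1` keeps the inverse radius positive when `B` or `M` vanishes.
  have hK : 0 < (∑ i, ∑ j, ∑ k, ‖B i j k‖) * |M| + 1 := by positivity
  refine ⟨_, inv_pos.2 hK, fun x z hx hz hd i => ?_⟩
  refine (hx i).exists_analyticOnNhd_ball hK fun n =>
    norm_iteratedDeriv_le_of_quadratic B (abs_nonneg M) (fun i => ?_) hx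
      (fun i => (hz i).trans (le_abs_self M)) hd n i
  refine le_trans ?_ (le_add_of_nonneg_right zero_le_one)
  refine mul_le_mul_of_nonneg_right ?_ (abs_nonneg M)
  exact Finset.single_le_sum (f := fun i => ∑ j, ∑ k, ‖B i j k‖) (fun i _ => by positivity)
    (Finset.mem_univ i)

/-! ### From uniform extension to continuation along curves -/

/-- Analytic solutions of `f(y', y) = 0` extend meromorphically to discs of a fixed radius. -/
def UniformlyExtends (f : MvPolynomial (Fin 2) ℂ) : Prop :=
  ∃ r > 0, ∀ (y : ℂ → ℂ) (z : ℂ), AnalyticAt ℂ y z → (∀ᶠ w in 𝓝 z, SatisfiesAt f y w) →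
    ∃ g : ℂ → ℂ, MeromorphicOn g (Metric.ball z r) ∧ y =ᶠ[𝓝 z] g

/-- Zeros of `g - h` are isolated unless it vanishes identically near `z`. Agreement of germs is
thus locally constant in the base point, as induction over connected sets requires. -/
theorem MeromorphicAt.eventually_eventuallyEq_iff {g h : ℂ → ℂ} {z : ℂ} (hg : MeromorphicAt g z)
    (hh : MeromorphicAt h z) : ∀ᶠ w in 𝓝 z, g =ᶠ[𝓝[≠] w] h ↔ g =ᶠ[𝓝[≠] z] h := by
  have hs : ∀ w, g =ᶠ[𝓝[≠] w] h ↔ ∀ᶠ v in 𝓝[≠] w, (g - h) v = 0 := fun w =>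
    eventually_congr (Eventually.of_forall fun v => by simp [sub_eq_zero])
  have hev : ∀ p : ℂ → Prop, (∀ᶠ v in 𝓝[≠] z, p v) → ∀ᶠ w in 𝓝 z, ∀ᶠ v in 𝓝[≠] w, p v := by
    intro p hp
    rw [eventually_nhdsWithin_iff, eventually_nhds_iff] at hp
    obtain ⟨U, hU, hUo, hzU⟩ := hp
    filter_upwards [hUo.mem_nhds hzU] with w hw
    by_cases hwz : w = z
    · subst hwz
      filter_upwards [mem_nhdsWithin_of_mem_nhds (hUo.mem_nhds hw), self_mem_nhdsWithin] with v h1 h2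
      exact hU v h1 h2
    · filter_upwards [mem_nhdsWithin_of_mem_nhds (hUo.mem_nhds hw), mem_nhdsWithin_of_mem_nhds
        (isOpen_ne.mem_nhds hwz)] with v h1 h2
      exact hU v h1 h2
  simp only [hs]
  rcases (hg.sub hh).eventually_eq_zero_or_eventually_ne_zero with h0 | h0
  · filter_upwards [hev _ h0] with w hw
    exact iff_of_true hw h0
  · filter_upwards [hev _ h0] with w hw
    refine iff_of_false (fun H => ?_) (fun H => ?_)
    · obtain ⟨v, h1, h2⟩ := (hw.and H).exists
      exact h1 h2
    · obtain ⟨v, h1, h2⟩ := (h0.and H).exists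
      exact h1 h2

/-- The identity theorem for meromorphic functions. -/
theorem MeromorphicOn.eventuallyEq_of_isPreconnected {g h : ℂ → ℂ} {z w : ℂ} {U : Set ℂ}
    (hU : IsPreconnected U) (hg : MeromorphicOn g U) (hh : MeromorphicOn h U)
    (hz : z ∈ U) (hw : w ∈ U) (hgh : g =ᶠ[𝓝[≠] z] h) : g =ᶠ[𝓝[≠] w] h := by
  have := hU.induction₂ (fun a b => g =ᶠ[𝓝[≠] a] h ↔ g =ᶠ[𝓝[≠] b] h)
    (fun a ha => by
      filter_upwards [mem_nhdsWithin_of_mem_nhds ((hg a ha).eventually_eventuallyEq_iff (hh a ha))]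
        with b hb using hb.symm)
    (fun _ _ _ _ _ _ => Iff.trans) (fun _ _ _ _ => Iff.symm) hz hw
  exact this.1 hgh

theorem UniformlyExtends.onlySingularitiesArePoles {f : MvPolynomial (Fin 2) ℂ}
    (hf : UniformlyExtends f) : OnlySingularitiesArePoles f := by
  obtain ⟨r, hr, H⟩ := hf
  intro γ y hy
  have hγ1 : Tendsto γ (𝓝[Set.Icc 0 1] 1) (𝓝 (γ 1)) := hy.continuousOn 1 (by simp)
  obtain ⟨δ, hδ, hball⟩ := Metric.mem_nhdsWithin_iff.1
    (hγ1 (Metric.ball_mem_nhds (γ 1) (half_pos hr)))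
  obtain ⟨t₀, ht₀, ht₀1⟩ : ∃ t₀, max 0 (1 - δ) < t₀ ∧ t₀ < 1 := exists_between (by simp [hδ])
  have ht₀0 : 0 < t₀ := (le_max_left _ _).trans_lt ht₀
  have ht₀δ : 1 - δ < t₀ := (le_max_right _ _).trans_lt ht₀
  have hclose : ∀ t ∈ Set.Ico t₀ 1, γ t ∈ Metric.ball (γ 1) (r / 2) := by
    intro t ht
    refine hball ⟨?_, ht₀0.le.trans ht.1, ht.2.le⟩
    rw [Metric.mem_ball, Real.dist_eq, abs_lt]
    constructor <;> linarith [ht.1, ht.2]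
  obtain ⟨hmer, hsat⟩ := hy.isSolutionAt t₀ ⟨ht₀0.le, ht₀1⟩
  -- A point `z` near `γ t₀` at which the germ is analytic.
  obtain ⟨ρ, hρ, hρmer⟩ : ∃ ρ > 0, MeromorphicOn (y t₀) (Metric.ball (γ t₀) ρ) := by
    have := hmer.eventually_analyticAt
    rw [eventually_nhdsWithin_iff, Metric.eventually_nhds_iff_ball] at this
    obtain ⟨ρ, hρ, h⟩ := this
    refine ⟨ρ, hρ, fun w hw => ?_⟩
    by_cases hwz : w = γ t₀
    · exact hwz ▸ hmer
    · exact (h w hw hwz).meromorphicAt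
  have hball' : ∀ᶠ w in 𝓝[≠] (γ t₀), w ∈ Metric.ball (γ t₀) ρ ∧ w ∈ Metric.ball (γ 1) (r / 2) :=
    mem_nhdsWithin_of_mem_nhds (inter_mem (Metric.ball_mem_nhds _ hρ)
      (Metric.isOpen_ball.mem_nhds (hclose t₀ ⟨le_rfl, ht₀1⟩)))
  obtain ⟨z, ⟨⟨hzρ, hzr⟩, hzan⟩, hzsat⟩ :=
    ((hball'.and hmer.eventually_analyticAt).and (eventually_eventually_nhdsWithin.2 hsat)
      |>.and self_mem_nhdsWithin).exists.imp fun z hz =>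
        (⟨hz.1.1, by
          have := hz.1.2
          rwa [isOpen_compl_singleton.nhdsWithin_eq hz.2] at this⟩ :
          ((z ∈ Metric.ball (γ t₀) ρ ∧ z ∈ Metric.ball (γ 1) (r / 2)) ∧ AnalyticAt ℂ (y t₀) z) ∧
            ∀ᶠ w in 𝓝 z, SatisfiesAt f (y t₀) w)
  obtain ⟨g, hg, hyg⟩ := H (y t₀) z hzan hzsat
  have hsub : ∀ w ∈ Metric.ball (γ 1) (r / 2), w ∈ Metric.ball z r := by
    intro w hw
    rw [Metric.mem_ball] at *
    linarith [dist_triangle_right w z (γ 1)]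
  -- The extension `g` is known to agree with `y t₀` only near `z`; the convex intersection of the
  -- two discs contains both `z` and `γ t₀`.
  have hstart : y t₀ =ᶠ[𝓝[≠] (γ t₀)] g := by
    refine MeromorphicOn.eventuallyEq_of_isPreconnected
      (U := Metric.ball (γ t₀) ρ ∩ Metric.ball (γ 1) (r / 2))
      ((convex_ball _ _).inter (convex_ball _ _)).isPreconnected
      (fun w hw => hρmer w hw.1) (fun w hw => hg w (hsub w hw.2)) ⟨hzρ, hzr⟩
      ⟨Metric.mem_ball_self hρ, hclose t₀ ⟨le_rfl, ht₀1⟩⟩ (hyg.filter_mono nhdsWithin_le_nhds)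
  have hstep : ∀ t ∈ Set.Ico t₀ 1, ∀ᶠ s in 𝓝[Set.Ico t₀ 1] t,
      (y t =ᶠ[𝓝[≠] (γ t)] g ↔ y s =ᶠ[𝓝[≠] (γ s)] g) := by
    intro t ht
    have ht' : t ∈ Set.Ico (0 : ℝ) 1 := ⟨ht₀0.le.trans ht.1, ht.2⟩
    have hγt : Tendsto γ (𝓝[Set.Ico t₀ 1] t) (𝓝 (γ t)) :=
      (hy.continuousOn t ⟨ht'.1, ht'.2.le⟩).mono_left
        (nhdsWithin_mono _ fun s hs => ⟨ht₀0.le.trans hs.1, hs.2.le⟩)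
    filter_upwards [nhdsWithin_mono t (Set.Ico_subset_Ico_left ht₀0.le) (hy.compatible t ht'),
      hγt.eventually ((hy.isSolutionAt t ht').1.eventually_eventuallyEq_iff
        (hg _ (hsub _ (hclose t ht))))] with s hs1 hs2
    exact hs2.symm.trans ⟨fun h => hs1.trans h, fun h => hs1.symm.trans h⟩
  refine ⟨g, hg _ (hsub _ (Metric.mem_ball_self (half_pos hr))), ?_⟩
  filter_upwards [Ico_mem_nhdsLT ht₀1] with t ht
  exact (isPreconnected_Ico.induction₂ (fun t s => y t =ᶠ[𝓝[≠] (γ t)] g ↔ y s =ᶠ[𝓝[≠] (γ s)] g)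
    hstep (fun _ _ _ _ _ _ => Iff.trans) (fun _ _ _ _ => Iff.symm) ⟨le_rfl, ht₀1⟩ ht).1 hstart

theorem EndsMeromorphically.endsAlgebraically {γ : ℝ → ℂ} {y : ℝ → ℂ → ℂ}
    (h : EndsMeromorphically γ y) : EndsAlgebraically γ y := by
  obtain ⟨g, hg, hy⟩ := h
  refine ⟨1, fun t => g (γ 1 + t), le_rfl, ?_, ?_⟩
  · refine MeromorphicAt.comp_analyticAt (f := g) (g := fun t => γ 1 + t) ?_ (by fun_prop)
    simpa using hg
  · filter_upwards [hy] with t ht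
    refine ⟨fun z => z - γ 1, by fun_prop, by simp, ?_⟩
    simpa using ht

/-! ### Absence of branch points and the Painlevé property -/

/-- A branched solution, restricted to a ray, would be a solution continued along a segment. -/
theorem OnlySingularitiesArePoles.not_isBranchPoint {f : MvPolynomial (Fin 2) ℂ}
    (hf : OnlySingularitiesArePoles f) (z₀ : ℂ) : ¬ IsBranchPoint f z₀ := by
  rintro ⟨m, Y, hm, hY, hsat, hno⟩
  have hm0 : (m : ℂ) ≠ 0 := by exact_mod_cast (by omega : m ≠ 0)
  have hev := hY.eventually_analyticAt.and hsat
  rw [eventually_nhdsWithin_iff, Metric.eventually_nhds_iff_ball] at hev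
  obtain ⟨ε, hε, hev⟩ := hev
  set σ : ℂ → ℂ := fun z => (z - z₀) ^ (1 / (m : ℂ)) with hσ
  have hσm : ∀ z, σ z ^ m = z - z₀ := fun z => by
    simp only [hσ, one_div]
    exact Complex.cpow_nat_inv_pow _ (by omega)
  -- `τ` descends the positive real axis from `ε / 2` to 0; there the principal root `σ` of `τ s ^
  -- m` is `τ s` itself.
  set τ : ℝ → ℂ := fun s => (((1 - s) * (ε / 2) : ℝ) : ℂ) with hτ
  set γ : ℝ → ℂ := fun s => z₀ + τ s ^ m with hγ
  have hpos : ∀ s ∈ Set.Ico (0 : ℝ) 1, 0 < (1 - s) * (ε / 2) := fun s hs =>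
    mul_pos (by linarith [hs.2]) (by linarith)
  have hσγ : ∀ s ∈ Set.Ico (0 : ℝ) 1, σ (γ s) = τ s := by
    intro s hs
    simp only [hσ, hγ, hτ, add_sub_cancel_left, one_div]
    have := (hpos s hs).le
    rw [← Complex.ofReal_pow, ← Complex.ofReal_natCast, ← Complex.ofReal_inv,
      ← Complex.ofReal_cpow (by positivity), Real.pow_rpow_inv_natCast this (by omega)]
  have hslit : ∀ s ∈ Set.Ico (0 : ℝ) 1, γ s - z₀ ∈ Complex.slitPlane := by
    intro s hs
    have := hpos s hs
    simp only [hγ, hτ, add_sub_cancel_left, ← Complex.ofReal_pow]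
    exact Complex.ofReal_mem_slitPlane.2 (by positivity)
  have hσan : ∀ z, z - z₀ ∈ Complex.slitPlane → AnalyticAt ℂ σ z := fun z hz => by
    refine AnalyticAt.cpow (by fun_prop) (by fun_prop) hz
  have hσd : ∀ z, z - z₀ ∈ Complex.slitPlane → σ z ≠ 0 ∧
      deriv σ z = 1 / ((m : ℂ) * σ z ^ (m - 1)) := by
    intro z hz
    have hz0 : σ z ≠ 0 := fun h => Complex.slitPlane_ne_zero hz (by
      rw [← hσm, h, zero_pow (by omega)])
    refine ⟨hz0, ?_⟩
    have h1 : HasDerivAt (fun w => σ w ^ m) (m * σ z ^ (m - 1) * deriv σ z) z :=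
      (hσan z hz).differentiableAt.hasDerivAt.fun_pow m
    have h2 : HasDerivAt (fun w => σ w ^ m) 1 z := by
      simp only [hσm]
      exact (hasDerivAt_id z).sub_const z₀
    rw [eq_div_iff (mul_ne_zero hm0 (pow_ne_zero _ hz0)), mul_comm]
    exact h1.unique h2
  have hτball : ∀ s ∈ Set.Ico (0 : ℝ) 1, τ s ∈ Metric.ball (0 : ℂ) ε := by
    intro s hs
    rw [mem_ball_zero_iff, hτ, Complex.norm_real, Real.norm_of_nonneg (hpos s hs).le]
    nlinarith [hs.1, hs.2]
  have hsol : IsSolutionAlong f γ (fun _ => Y ∘ σ) := by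
    refine ⟨?_, fun s hs => ?_, fun t _ => Eventually.of_forall fun s => EventuallyEq.rfl⟩
    · refine Continuous.continuousOn ?_
      fun_prop
    · have hev1 : ∀ᶠ z in 𝓝 (γ s), z - z₀ ∈ Complex.slitPlane :=
        (continuous_id.sub continuous_const).continuousAt.eventually_mem
          (Complex.isOpen_slitPlane.mem_nhds (hslit s hs))
      have hev2 : ∀ᶠ z in 𝓝 (γ s), σ z ∈ Metric.ball (0 : ℂ) ε :=
        (hσan _ (hslit s hs)).continuousAt.eventually_mem
          (Metric.isOpen_ball.mem_nhds (hσγ s hs ▸ hτball s hs))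
      refine ⟨?_, mem_nhdsWithin_of_mem_nhds ?_⟩
      · refine (AnalyticAt.comp ?_ (hσan _ (hslit s hs))).meromorphicAt
        exact (hev _ hev2.self_of_nhds (hσd _ (hslit s hs)).1).1
      · filter_upwards [hev1, hev2] with z h1 h2
        obtain ⟨h3, h4⟩ := hσd z h1
        obtain ⟨h5, h6⟩ := hev _ h2 h3
        show MvPolynomial.eval _ f = 0
        rw [deriv_comp z h5.differentiableAt (hσan z h1).differentiableAt, h4, mul_one_div]
        exact h6
  obtain ⟨g, hg, hend⟩ := hf γ _ hsol
  have hγ1 : γ 1 = z₀ := by simp [hγ, hτ, show m ≠ 0 by omega]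
  rw [hγ1] at hg
  refine hno ⟨g, hg, ?_⟩
  have hgm : MeromorphicAt (fun t => g (z₀ + t ^ m)) 0 := by
    refine MeromorphicAt.comp_analyticAt (f := g) (g := fun t => z₀ + t ^ m) ?_ (by fun_prop)
    simpa [show m ≠ 0 by omega] using hg
  -- The points `τ s` accumulate at 0, so equality there forces `Y t = g (z₀ + t ^ m)` near 0.
  have hfreq : ∃ᶠ t in 𝓝[≠] (0 : ℂ), (Y - fun t => g (z₀ + t ^ m)) t = 0 := by
    have hIco : Set.Ico (0 : ℝ) 1 ∈ 𝓝[<] (1 : ℝ) := Ico_mem_nhdsLT one_pos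
    have hτ0 : ∀ s ∈ Set.Ico (0 : ℝ) 1, τ s ≠ 0 := fun s hs => by
      simpa only [hτ, Complex.ofReal_ne_zero] using (hpos s hs).ne'
    have hτlim : Tendsto τ (𝓝[<] 1) (𝓝[≠] 0) := by
      refine tendsto_nhdsWithin_iff.2 ⟨?_, by filter_upwards [hIco] with s hs using hτ0 s hs⟩
      have : Continuous τ := by fun_prop
      simpa [hτ] using (this.tendsto 1).mono_left nhdsWithin_le_nhds
    have hγlim : Tendsto γ (𝓝[<] 1) (𝓝[≠] z₀) := by
      refine tendsto_nhdsWithin_iff.2 ⟨?_, ?_⟩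
      · have : Continuous γ := by fun_prop
        simpa [hγ1] using (this.tendsto 1).mono_left nhdsWithin_le_nhds
      · filter_upwards [hIco] with s hs
        simpa [hγ] using fun h => absurd h (hτ0 s hs)
    refine hτlim.frequently (Eventually.frequently ?_)
    filter_upwards [hIco, hend, hγlim.eventually hg.eventually_analyticAt] with s hs h1 h2
    have hc : ContinuousAt (Y ∘ σ) (γ s) := by
      refine ContinuousAt.comp ?_ (hσan _ (hslit s hs)).continuousAt
      exact (hev _ (hσγ s hs ▸ hτball s hs) (hσd _ (hslit s hs)).1).1.continuousAt
    have := ((hc.eventuallyEq_nhds_iff_eventuallyEq_nhdsNE h2.continuousAt).1 h1).self_of_nhds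
    simpa [hσγ s hs, sub_eq_zero] using this
  have := ((hY.sub hgm).frequently_zero_iff_eventuallyEq_zero).1 hfreq
  filter_upwards [this] with t ht
  exact sub_eq_zero.1 ht

theorem OnlySingularitiesArePoles.hasPainleveProperty {f : MvPolynomial (Fin 2) ℂ}
    (hf : OnlySingularitiesArePoles f) : HasPainleveProperty f := by
  constructor
  · rw [Set.eq_empty_of_forall_notMem (s := {z₀ | IsBranchPoint f z₀}) hf.not_isBranchPoint]
    exact Set.subsingleton_empty.isDiscrete
  · rw [Set.eq_empty_of_forall_notMem (s := {z₀ | IsEssentialSingularity f z₀})]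
    · exact Set.subsingleton_empty.isDiscrete
    · rintro z₀ ⟨γ, y, -, hy, hn⟩
      exact hn (hf γ y hy).endsAlgebraically

/-! ### The two equations, beginning with Riccati -/

theorem satisfiesAt_riccati {a₀ a₁ a₂ : ℂ} {y : ℂ → ℂ} {z : ℂ} :
    SatisfiesAt (riccati a₀ a₁ a₂) y z ↔ deriv y z = a₀ + a₁ * y z + a₂ * y z ^ 2 := by
  simp [SatisfiesAt, riccati, sub_eq_zero]

theorem satisfiesAt_weierstrass {c a b : ℂ} {y : ℂ → ℂ} {z : ℂ} :
    SatisfiesAt (weierstrass c a b) y z ↔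
      c ^ 2 * deriv y z ^ 2 = y z ^ 3 + a * y z + b := by
  simp [SatisfiesAt, weierstrass, sub_eq_zero, mul_pow]

/-- Analytic solutions of a Riccati equation which are bounded by `1` at a point extend
analytically to a disc of fixed radius. -/
theorem exists_radius_of_riccati (a₀ a₁ a₂ : ℂ) :
    ∃ r > 0, ∀ (y : ℂ → ℂ) (z : ℂ), AnalyticAt ℂ y z → ‖y z‖ ≤ 1 →
      (deriv y =ᶠ[𝓝 z] fun w => a₀ + a₁ * y w + a₂ * y w ^ 2) →
      ∃ g : ℂ → ℂ, AnalyticOnNhd ℂ g (Metric.ball z r) ∧ y =ᶠ[𝓝 z] g := by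
  -- Index 0 carries the constant function 1, whose derivative is 0; index 1 carries `y`.
  obtain ⟨r, hr, H⟩ := exists_radius_of_quadratic
    (![fun _ _ => 0, ![![a₀, a₁], ![0, a₂]]] : Fin 2 → Fin 2 → Fin 2 → ℂ) 1
  refine ⟨r, hr, fun y z hy hyz hd => H ![fun _ => 1, y] z ?_ ?_ ?_ 1⟩
  · exact Fin.forall_fin_two.2 ⟨analyticAt_const, hy⟩
  · exact Fin.forall_fin_two.2 ⟨by simp, hyz⟩
  · refine Fin.forall_fin_two.2 ⟨?_, ?_⟩
    · exact Eventually.of_forall fun w => by simp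
    · filter_upwards [hd] with w hw
      simp [Fin.sum_univ_two, hw, sq]

/-- The reciprocal `w = 1 / y` satisfies `w' = -a₂ - a₁ w - a₀ w ^ 2`, again a Riccati equation, and
one of `y`, `w` is bounded by 1 at the given point. -/
theorem uniformlyExtends_riccati (a₀ a₁ a₂ : ℂ) : UniformlyExtends (riccati a₀ a₁ a₂) := by
  obtain ⟨r₁, hr₁, H₁⟩ := exists_radius_of_riccati a₀ a₁ a₂
  obtain ⟨r₂, hr₂, H₂⟩ := exists_radius_of_riccati (-a₂) (-a₁) (-a₀)
  refine ⟨min r₁ r₂, lt_min hr₁ hr₂, fun y z hy hs => ?_⟩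
  simp only [satisfiesAt_riccati] at hs
  rcases le_total ‖y z‖ 1 with h | h
  · obtain ⟨g, hg, hyg⟩ := H₁ y z hy h hs
    exact ⟨g, fun w hw => (hg w (Metric.ball_subset_ball (min_le_left _ _) hw)).meromorphicAt, hyg⟩
  · have hyz : y z ≠ 0 := norm_pos_iff.1 (by linarith)
    obtain ⟨g, hg, hyg⟩ := H₂ (fun w => (y w)⁻¹) z (hy.fun_inv hyz)
      (by simpa using inv_le_one_of_one_le₀ h) (by
        filter_upwards [hs, hy.continuousAt.eventually_ne hyz, hy.eventually_analyticAt]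
          with w h1 h2 h3
        rw [deriv_fun_inv'' h3.differentiableAt h2, h1]
        field_simp
        ring)
    refine ⟨fun w => (g w)⁻¹, fun w hw =>
      (hg w (Metric.ball_subset_ball (min_le_right _ _) hw)).meromorphicAt.inv, ?_⟩
    filter_upwards [hyg] with w hw
    rw [← hw, inv_inv]

/-! ### The Weierstrass equation -/

/-- Analytic solutions of a system `p' = P(1, p, q)`, `q' = Q(1, p, q)` with quadratic forms `P`, `Q`
which are bounded by `M` at a point extend to a disc of fixed radius. -/
theorem exists_radius_of_quadratic_pair (P Q : Fin 3 → Fin 3 → ℂ) (M : ℝ) :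
    ∃ r > 0, ∀ (p q : ℂ → ℂ) (z : ℂ), AnalyticAt ℂ p z → AnalyticAt ℂ q z →
      ‖p z‖ ≤ M → ‖q z‖ ≤ M →
      (∀ᶠ w in 𝓝 z, deriv p w = ∑ j, ∑ k, P j k * (![1, p w, q w] j * ![1, p w, q w] k) ∧
        deriv q w = ∑ j, ∑ k, Q j k * (![1, p w, q w] j * ![1, p w, q w] k)) →
      ∃ g h : ℂ → ℂ, AnalyticOnNhd ℂ g (Metric.ball z r) ∧ AnalyticOnNhd ℂ h (Metric.ball z r) ∧
        p =ᶠ[𝓝 z] g ∧ q =ᶠ[𝓝 z] h := by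
  obtain ⟨r, hr, H⟩ := exists_radius_of_quadratic
    (![fun _ _ => 0, P, Q] : Fin 3 → Fin 3 → Fin 3 → ℂ) (max M 1)
  refine ⟨r, hr, fun p q z hp hq hpz hqz hd => ?_⟩
  have hv : ∀ w, (fun j => (![fun _ => 1, p, q] : Fin 3 → ℂ → ℂ) j w) = ![1, p w, q w] := fun w => by
    ext j
    fin_cases j <;> rfl
  have K := H ![fun _ => 1, p, q] z
    (by
      rw [Fin.forall_fin_succ, Fin.forall_fin_two]
      exact ⟨analyticAt_const, hp, hq⟩)
    (by
      rw [Fin.forall_fin_succ, Fin.forall_fin_two]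
      exact ⟨by simp, hpz.trans (le_max_left _ _), hqz.trans (le_max_left _ _)⟩)
    (by
      rw [Fin.forall_fin_succ, Fin.forall_fin_two]
      refine ⟨Eventually.of_forall fun w => by simp, ?_, ?_⟩
      · filter_upwards [hd] with w hw
        simp only [← hv w] at hw
        exact hw.1
      · filter_upwards [hd] with w hw
        simp only [← hv w] at hw
        exact hw.2)
  obtain ⟨g, hg, hpg⟩ := K 1
  obtain ⟨h, hh, hqh⟩ := K 2
  exact ⟨g, h, hg, hh, hpg, hqh⟩

theorem norm_le_of_norm_pow_three_le {x : ℂ} {A B : ℝ} (hA : 0 ≤ A) (hB : 0 ≤ B)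
    (h : ‖x‖ ^ 3 ≤ A * ‖x‖ + B) : ‖x‖ ≤ 1 + A + B := by
  by_contra! hx
  nlinarith [norm_nonneg x, mul_nonneg hB (by linarith : 0 ≤ ‖x‖ - 1),
    mul_nonneg (norm_nonneg x) (by linarith : 0 ≤ ‖x‖ - (1 + A + B)),
    mul_nonneg (sq_nonneg ‖x‖) (by linarith : 0 ≤ ‖x‖ - 1)]

/-- A non-constant solution of the Weierstrass equation satisfies the differentiated equation. -/
theorem deriv_deriv_of_weierstrass {c a b : ℂ} (hc : c ≠ 0) {y : ℂ → ℂ} {z : ℂ}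
    (hy : AnalyticAt ℂ y z) (hs : ∀ᶠ w in 𝓝 z, c ^ 2 * deriv y w ^ 2 = y w ^ 3 + a * y w + b)
    (h0 : ¬ ∀ᶠ w in 𝓝 z, deriv y w = 0) :
    deriv (deriv y) =ᶠ[𝓝 z] fun w => (3 * y w ^ 2 + a) / (2 * c ^ 2) := by
  have hne := hy.deriv.eventually_eq_zero_or_eventually_ne_zero.resolve_left h0
  -- Differentiating gives the claim multiplied by `y'`. Cancelling needs `y' ≠ 0`, known off `z`
  -- only; the identity theorem restores a full neighbourhood.
  refine ((hy.deriv.deriv.frequently_eq_iff_eventually_eq (by fun_prop)).1 ?_)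
  refine Eventually.frequently ?_
  filter_upwards [hne, nhdsWithin_le_nhds hs.eventually_nhds,
    nhdsWithin_le_nhds hy.eventually_analyticAt] with w h1 h2 h3
  have e1 : HasDerivAt (fun w => c ^ 2 * deriv y w ^ 2)
      (c ^ 2 * (2 * deriv y w ^ 1 * deriv (deriv y) w)) w :=
    (h3.deriv.differentiableAt.hasDerivAt.fun_pow 2).const_mul _
  have hyw := h3.differentiableAt.hasDerivAt
  have e2 : HasDerivAt (fun w => y w ^ 3 + a * y w + b)
      (3 * y w ^ 2 * deriv y w + a * deriv y w) w :=
    ((hyw.fun_pow 3).add (hyw.const_mul a)).add_const b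
  have e3 := e1.unique (e2.congr_of_eventuallyEq h2)
  rw [eq_div_iff (by simp [hc])]
  refine mul_right_cancel₀ h1 ?_
  linear_combination e3

theorem uniformlyExtends_weierstrass {c : ℂ} (a b : ℂ) (hc : c ≠ 0) :
    UniformlyExtends (weierstrass c a b) := by
  -- This is the bound of `norm_le_of_norm_pow_three_le` with `A = ‖a‖`, `B = ‖b‖ + ‖c‖ ^ 2`, valid
  -- in both charts.
  set M : ℝ := 1 + ‖a‖ + (‖b‖ + ‖c‖ ^ 2) with hM
  have hM1 : 1 ≤ M := by
    have : 0 ≤ ‖a‖ + (‖b‖ + ‖c‖ ^ 2) := by positivity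
    linarith
  -- Affine chart `(y, y')`, used where `‖y'‖ ≤ 1`.
  obtain ⟨r₁, hr₁, H₁⟩ := exists_radius_of_quadratic_pair
    ![![0, 0, 1], 0, 0] ![![a / (2 * c ^ 2), 0, 0], ![0, 3 / (2 * c ^ 2), 0], 0] M
  -- Chart at infinity `u = y / y'`, `v = 1 / y'`, where the curve is `c² v = u³ + a u v² + b v³`.
  -- The original equation eliminates `y³` from `u'`, leaving a quadratic form in `1, u, v`.
  obtain ⟨r₂, hr₂, H₂⟩ := exists_radius_of_quadratic_pair
    ![![-1 / 2, 0, 0], ![0, 0, 2 * a / (2 * c ^ 2)], ![0, 0, 3 * b / (2 * c ^ 2)]]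
    ![0, ![0, -3 / (2 * c ^ 2), 0], ![0, 0, -a / (2 * c ^ 2)]] M
  refine ⟨min r₁ r₂, lt_min hr₁ hr₂, fun y z hy hs => ?_⟩
  simp only [satisfiesAt_weierstrass] at hs
  -- Constant solutions need not satisfy the differentiated equation, but extend trivially.
  by_cases h0 : ∀ᶠ w in 𝓝 z, deriv y w = 0
  · refine ⟨fun _ => y z, fun w _ => .const _ w, ?_⟩
    obtain ⟨ε, hε, h⟩ := Metric.eventually_nhds_iff_ball.1 (h0.and hy.eventually_analyticAt)
    filter_upwards [Metric.ball_mem_nhds z hε] with w hw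
    exact Metric.isOpen_ball.is_const_of_deriv_eq_zero (convex_ball z ε).isPreconnected
      (fun v hv => (h v hv).2.differentiableAt.differentiableWithinAt) (fun v hv => (h v hv).1)
      hw (Metric.mem_ball_self hε)
  have hd := deriv_deriv_of_weierstrass hc hy hs h0
  have hz := hs.self_of_nhds
  rcases le_total ‖deriv y z‖ 1 with h | h
  · have hyM : ‖y z‖ ≤ M := by
      refine norm_le_of_norm_pow_three_le (norm_nonneg a) (by positivity) ?_
      calc ‖y z‖ ^ 3 = ‖c ^ 2 * deriv y z ^ 2 - a * y z - b‖ := by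
            rw [← norm_pow]
            congr 1
            linear_combination -hz
        _ ≤ ‖c‖ ^ 2 * ‖deriv y z‖ ^ 2 + ‖a‖ * ‖y z‖ + ‖b‖ := by
            refine (norm_sub_le _ _).trans (add_le_add_left ((norm_sub_le _ _).trans ?_) _)
            simp
        _ ≤ ‖c‖ ^ 2 * 1 + ‖a‖ * ‖y z‖ + ‖b‖ := by
            gcongr
            exact pow_le_one₀ (norm_nonneg _) h
        _ = _ := by ring
    obtain ⟨g, _, hg, -, hyg, -⟩ := H₁ y (deriv y) z hy hy.deriv hyM (h.trans hM1) (by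
      filter_upwards [hd] with w hw
      simp [Fin.sum_univ_three, hw]
      field_simp
      ring)
    exact ⟨g, fun w hw => (hg w (Metric.ball_subset_ball (min_le_left _ _) hw)).meromorphicAt, hyg⟩
  · have hyz : deriv y z ≠ 0 := norm_pos_iff.1 (by linarith)
    have hv1 : ‖(deriv y z)⁻¹‖ ≤ 1 := by simpa using inv_le_one_of_one_le₀ h
    have huM : ‖y z / deriv y z‖ ≤ M := by
      refine norm_le_of_norm_pow_three_le (norm_nonneg a) (by positivity) ?_
      set u := y z / deriv y z with hu
      set v := (deriv y z)⁻¹ with hv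
      calc ‖u‖ ^ 3 = ‖c ^ 2 * v - a * u * v ^ 2 - b * v ^ 3‖ := by
            rw [← norm_pow]
            congr 1
            rw [hu, hv]
            field_simp
            linear_combination -hz
        _ ≤ ‖c‖ ^ 2 * ‖v‖ + ‖a‖ * ‖u‖ * ‖v‖ ^ 2 + ‖b‖ * ‖v‖ ^ 3 := by
            refine (norm_sub_le _ _).trans (add_le_add ((norm_sub_le _ _).trans ?_) ?_) <;> simp
        _ ≤ ‖c‖ ^ 2 * 1 + ‖a‖ * ‖u‖ * 1 + ‖b‖ * 1 := by
            gcongr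
            exacts [pow_le_one₀ (norm_nonneg _) hv1, pow_le_one₀ (norm_nonneg _) hv1]
        _ = _ := by ring
    obtain ⟨g, k, hg, hk, hyg, hyk⟩ := H₂ (fun w => y w / deriv y w) (fun w => (deriv y w)⁻¹) z
      (hy.fun_div hy.deriv hyz) (hy.deriv.fun_inv hyz) huM (hv1.trans hM1) (by
        filter_upwards [hd, hs, hy.deriv.continuousAt.eventually_ne hyz, hy.eventually_analyticAt]
          with w h1 h2 h3 h4
        rw [deriv_fun_inv'' h4.deriv.differentiableAt h3,
          deriv_fun_div h4.differentiableAt h4.deriv.differentiableAt h3, h1]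
        constructor
        · simp [Fin.sum_univ_three]
          field_simp
          linear_combination 3 * h2
        · simp [Fin.sum_univ_three]
          field_simp
          ring)
    have hsub := Metric.ball_subset_ball (x := z) (min_le_right r₁ r₂)
    refine ⟨fun w => g w / k w, fun w hw =>
      (hg w (hsub hw)).meromorphicAt.div (hk w (hsub hw)).meromorphicAt, ?_⟩
    filter_upwards [hyg, hyk, hy.deriv.continuousAt.eventually_ne hyz] with w h1 h2 h3
    rw [← h1, ← h2]
    field_simp

theorem corollary2p3 :
    (∀ a₀ a₁ a₂ : ℂ, HasPainleveProperty (riccati a₀ a₁ a₂) ∧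
      OnlySingularitiesArePoles (riccati a₀ a₁ a₂)) ∧
    (∀ c a b : ℂ, c ≠ 0 → 4 * a ^ 3 + 27 * b ^ 2 ≠ 0 →
      HasPainleveProperty (weierstrass c a b) ∧
      OnlySingularitiesArePoles (weierstrass c a b)) := by
  constructor
  · intro a₀ a₁ a₂
    have h := (uniformlyExtends_riccati a₀ a₁ a₂).onlySingularitiesArePoles
    exact ⟨h.hasPainleveProperty, h⟩
  · intro c a b hc _
    have h := (uniformlyExtends_weierstrass a b hc).onlySingularitiesArePoles
    exact ⟨h.hasPainleveProperty, h⟩
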